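/- Let $q$ be a prime power, let $1\le\lambda\le\rho$ be integers, and let $n,r$ be positive integers with $n\lambda=r\rho$. The ensemble $\mathrm{LDPC}(\lambda,\rho;n)$ without codeword removal is defined as follows. Take $n$ variable nodes with $\lambda$ sockets each and $r$ check nodes with $\rho$ sockets each; match the $n\lambda$ variable-node sockets with the $r\rho$ check-node sockets by a uniformly random bijection, each matched pair being an edge; and label every edge, independently of the matching and of the other edges, by a uniformly random element $g_e$ of $\mathrm{GF}(q)\setminus\{0\}$. The random code $\boldsymbol C$ is the set of all $u\in\mathrm{GF}(q)^n$ such that, for every check node $j$, $\sum_{e}g_e u_{i(e)}=0$, where the sum is over all edges $e$ at $j$ (parallel edges counted separately) and $i(e)$ is the variable node of $e$. Let $R=1-\lambda/\rho$ be the design rate and $R_{\boldsymbol C}=\frac1n\log_q|\boldsymbol C|$ the actual rate. For fixed $q,\lambda,\rho$ and any $\epsilon>0$ there exists an integer $n(\epsilon)$ such that, for all $n>n(\epsilon)$ with $\rho\mid n\lambda$, $$\Pr[R_{\boldsymbol C}-R>\epsilon]\le q^{-n\epsilon/2}.$$ In addition, for any $\epsilon>0$ there exists $T_0>0$ such that,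 for all $n>n(\epsilon)$ with $\rho\mid n\lambda$, $$\mathbb E[R_{\boldsymbol C}-R]\le T_0\,\frac{\log_q n}{n}.$$ -/

import Mathlib

open MeasureTheory ProbabilityTheory
open scoped BigOperators

namespace LDPC

/-- A labelled `(l, d)`-regular bipartite Tanner multigraph with `n` variable nodes and `r` check
nodes, with edge constants in `F \ {0}`, as produced by the socket (permutation) construction.
Variable node `i` has the sockets `(i, s)`, `s : Fin l`; check node `j` has the sockets `(j, t)`,
`t : Fin d`; the bijection `perm` matches the variable-node sockets with the check-node sockets.
An edge is identified with its variable-node socket `e`: it joins the variable node `e.1` to the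
check node `(perm e).1` and carries the nonzero constant `label e`. -/
structure TannerGraph (F : Type*) [Field F] (l d n r : ℕ) where
  perm : (Fin n × Fin l) ≃ (Fin r × Fin d)
  label : Fin n × Fin l → Fˣ

namespace TannerGraph

variable {F : Type*} [Field F] {l d n r : ℕ}

/-- The edges incident to check node `j` (parallel edges are kept as separate edges). -/
def edgesAt (G : TannerGraph F l d n r) (j : Fin r) : Finset (Fin n × Fin l) :=
  Finset.univ.filter fun e => (G.perm e).1 = j

/-- The full codebook: all vectors satisfying the parity check of every check node. -/
def codebook (G : TannerGraph F l d n r) : Set (Fin n → F) :=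
  {u | ∀ j : Fin r, ∑ e ∈ G.edgesAt j, (G.label e : F) * u e.1 = 0}

/-- The actual rate of the code, in `q`-ary symbols per channel use (`q = |F|`): the number of
codewords is `q ^ (n * rate)`. -/
noncomputable def rate [Fintype F] (G : TannerGraph F l d n r) : ℝ :=
  Real.logb (Fintype.card F) (G.codebook.ncard) / n

instance : MeasurableSpace (TannerGraph F l d n r) := ⊤

instance : DiscreteMeasurableSpace (TannerGraph F l d n r) := ⟨fun _ => trivial⟩

instance [Fintype F] : Finite (TannerGraph F l d n r) :=
  Finite.of_injective
    (fun G : TannerGraph F l d n r => (G.perm, G.label))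
    (fun G H h => by
      cases G; cases H
      simpa using h)

theorem nonempty (h : n * l = r * d) : Nonempty (TannerGraph F l d n r) :=
  ⟨⟨Fintype.equivOfCardEq (by simpa using h), fun _ => 1⟩⟩

end TannerGraph

/-- The design rate `1 - l / d` of the `(l, d)`-regular ensemble. -/
noncomputable def designRate (l d : ℕ) : ℝ := 1 - (l : ℝ) / (d : ℝ)

/-- The random ensemble without codeword removal: the socket matching is uniform over all
matchings, and the edge constants are independent and uniform over the nonzero field elements.
Jointly, this is the uniform distribution on labelled Tanner graphs. It is a probability measure
whenever `n * l = r * d`. -/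
noncomputable def fullEnsemble (F : Type*) [Field F] (l d n r : ℕ) :
    Measure (TannerGraph F l d n r) :=
  uniformOn Set.univ

theorem isProbabilityMeasure_fullEnsemble (F : Type*) [Field F] [Fintype F] {l d n r : ℕ}
    (h : n * l = r * d) : IsProbabilityMeasure (fullEnsemble F l d n r) := by
  have : Nonempty (TannerGraph F l d n r) := TannerGraph.nonempty h
  exact isProbabilityMeasure_uniformOn Set.finite_univ Set.univ_nonempty

end LDPC

/-! Fix `u` of weight `w`. Permuting the check-node sockets and rescaling their edges preserves the
ensemble, so the word that `u` sends to the sockets is uniform on the Hamming sphere of weight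
`w * l`, and `ℙ[u ∈ C]` is the fraction of this sphere which satisfies the checks. Compare both with
i.i.d. symbols that are nonzero with probability `w / n`, under which every word of this sphere has
probability `x = D ^ l`, where `D` is the probability of `u` under the same law.

* The binomial weight is most likely to equal its mean, so the sphere has probability at least
  `1 / (n * l + 1)`.
* A word satisfying the checks is determined by what remains after deleting the `t`-th socket of
  every check node, so the marginal probabilities of these remainders sum to at most `1`. Their
  geometric mean over `t` is `x ^ (1 - 1 / d)`, and AM-GM shows that at most `x ^ (-(1 - 1 / d))`
  words of the sphere satisfy the checks.

Hence `ℙ[u ∈ C] ≤ (n * l + 1) * D ^ (l / d)`, and `D` is at most the inverse of the number of words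
of weight `w`. Summing over `u` gives `𝔼 |C| ≤ (n * l + 1) * (n + 1) * q ^ (n * R)`. Markov's
inequality yields the tail bound and Jensen's inequality for the logarithm the expectation bound.
-/

namespace LDPC

open Finset
open scoped Nat

section Binomial

theorem pow_mul_factorial_le (a k : ℕ) : a ^ k * a ! ≤ a ^ a * k ! := by
  rcases le_total k a with h | h
  · calc a ^ k * a ! = a ^ k * (k ! * a.descFactorial (a - k)) := by
          rw [← Nat.factorial_mul_descFactorial (Nat.sub_le a k), Nat.sub_sub_self h]
      _ ≤ a ^ k * (k ! * a ^ (a - k)) := by gcongr; exact Nat.descFactorial_le_pow _ _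
      _ = a ^ a * k ! := by rw [mul_left_comm, ← pow_add, Nat.add_sub_cancel' h, mul_comm]
  · calc a ^ k * a ! = a ^ a * (a ! * a ^ (k - a)) := by
          rw [mul_left_comm, ← pow_add, Nat.add_sub_cancel' h, mul_comm]
      _ ≤ a ^ a * k ! := by gcongr; exact Nat.factorial_mul_pow_sub_le_factorial h

theorem choose_mul_pow_mul_pow_le {a b i j : ℕ} (h : i + j = a + b) :
    (a + b).choose i * a ^ i * b ^ j ≤ (a + b).choose a * a ^ a * b ^ b := by
  have choose_i : (a + b).choose i * i ! * j ! = (a + b)! :=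
    h ▸ Nat.choose_symm_add (a := i) ▸ Nat.add_choose_mul_factorial_mul_factorial i j
  have choose_a : (a + b).choose a * a ! * b ! = (a + b)! :=
    Nat.choose_symm_add (a := a) ▸ Nat.add_choose_mul_factorial_mul_factorial a b
  refine Nat.le_of_mul_le_mul_right ?_ (by positivity : 0 < i ! * j ! * (a ! * b !))
  calc (a + b).choose i * a ^ i * b ^ j * (i ! * j ! * (a ! * b !))
      = (a + b)! * ((a ^ i * a !) * (b ^ j * b !)) := by rw [← choose_i]; ring
    _ ≤ (a + b)! * ((a ^ a * i !) * (b ^ b * j !)) :=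
        Nat.mul_le_mul_left _ <|
          Nat.mul_le_mul (pow_mul_factorial_le a i) (pow_mul_factorial_le b j)
    _ = (a + b).choose a * a ^ a * b ^ b * (i ! * j ! * (a ! * b !)) := by rw [← choose_a]; ring

theorem add_pow_add_le (a b : ℕ) :
    (a + b) ^ (a + b) ≤ (a + b + 1) * ((a + b).choose a * a ^ a * b ^ b) := by
  calc (a + b) ^ (a + b)
      = ∑ i ∈ range (a + b + 1), (a + b).choose i * a ^ i * b ^ (a + b - i) := by
        rw [add_pow]
        exact sum_congr rfl fun i _ => by simp only [Nat.cast_id]; ring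
    _ ≤ ∑ _i ∈ range (a + b + 1), (a + b).choose a * a ^ a * b ^ b :=
        sum_le_sum fun i hi =>
          choose_mul_pow_mul_pow_le (Nat.add_sub_cancel' (Nat.lt_succ_iff.1 (mem_range.1 hi)))
    _ = (a + b + 1) * ((a + b).choose a * a ^ a * b ^ b) := by simp

theorem one_le_mul_binomial_mean {N k : ℕ} (hk : k ≤ N) {θ : ℝ} (hθ : θ * N = k) :
    1 ≤ (N + 1) * (N.choose k * θ ^ k * (1 - θ) ^ (N - k)) := by
  obtain ⟨b, rfl⟩ := Nat.exists_eq_add_of_le hk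
  have hb : (1 - θ) * (k + b : ℕ) = b := by push_cast at hθ ⊢; linarith
  have pos : (0 : ℝ) < ((k + b : ℕ) : ℝ) ^ (k + b) := by exact_mod_cast Nat.pow_self_pos
  refine le_of_mul_le_mul_right ?_ pos
  calc 1 * ((k + b : ℕ) : ℝ) ^ (k + b)
      ≤ ((k + b : ℕ) + 1) * ((k + b).choose k * (k : ℝ) ^ k * (b : ℝ) ^ b) := by
        rw [one_mul]; exact_mod_cast add_pow_add_le k b
    _ = ((k + b : ℕ) + 1) * ((k + b).choose k * (θ * (k + b : ℕ)) ^ k *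
          ((1 - θ) * (k + b : ℕ)) ^ b) := by rw [hθ, hb]
    _ = ((k + b : ℕ) + 1) * ((k + b).choose k * θ ^ k * (1 - θ) ^ (k + b - k)) *
          ((k + b : ℕ) : ℝ) ^ (k + b) := by
        rw [Nat.add_sub_cancel_left, mul_pow, mul_pow, pow_add]; ring

theorem choose_mul_pow_mul_pow_le_one {N k : ℕ} (hk : k ≤ N) {θ : ℝ} (h0 : 0 ≤ θ) (h1 : θ ≤ 1) :
    N.choose k * θ ^ k * (1 - θ) ^ (N - k) ≤ 1 := by
  have := sub_nonneg.2 h1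
  calc N.choose k * θ ^ k * (1 - θ) ^ (N - k) = θ ^ k * (1 - θ) ^ (N - k) * N.choose k := by ring
    _ ≤ ∑ i ∈ range (N + 1), θ ^ i * (1 - θ) ^ (N - i) * N.choose i :=
        single_le_sum (f := fun i => θ ^ i * (1 - θ) ^ (N - i) * N.choose i)
          (fun i _ => by positivity) (mem_range.2 (Nat.lt_succ_of_le hk))
    _ = 1 := by rw [← add_pow, add_sub_cancel, one_pow]

end Binomial

theorem sum_card_fiber_rpow_neg_le {α β : Type*} [Fintype α] [DecidableEq β] {f : α → β}
    {t : Finset β} (ht : ∀ x, f x ∈ t) {s : ℝ} (hs : s ≤ 1) :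
    ∑ x, (#{y | f y = f x} : ℝ) ^ (-s) ≤ #t * (Fintype.card α : ℝ) ^ (1 - s) := by
  have fiber_le : ∀ b ∈ t, ∑ x with f x = b, (#{y | f y = f x} : ℝ) ^ (-s) ≤
      (Fintype.card α : ℝ) ^ (1 - s) := by
    intro b _
    rw [sum_congr rfl fun x hx => by rw [(mem_filter.1 hx).2], sum_const, nsmul_eq_mul]
    rcases (#{y | f y = b}).eq_zero_or_pos with h | h
    · rw [h, Nat.cast_zero, zero_mul]
      positivity
    · calc (#{y | f y = b} : ℝ) * (#{y | f y = b} : ℝ) ^ (-s) = (#{y | f y = b} : ℝ) ^ (1 - s) := by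
            rw [sub_eq_add_neg, Real.rpow_add (Nat.cast_pos.2 h), Real.rpow_one]
        _ ≤ (Fintype.card α : ℝ) ^ (1 - s) :=
            Real.rpow_le_rpow (Nat.cast_nonneg _) (Nat.cast_le.2 (card_le_univ _))
              (sub_nonneg.2 hs)
  rw [← sum_fiberwise_of_maps_to (fun x _ => ht x)]
  exact (sum_le_sum fiber_le).trans_eq (by rw [sum_const, nsmul_eq_mul])

section Hamming

/-- The Hamming sphere of radius `w` centred at the zero word. -/
def sphere (F ι : Type*) [Zero F] [Fintype F] [DecidableEq F] [Fintype ι] [DecidableEq ι] (w : ℕ) :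
    Finset (ι → F) :=
  {v | hammingNorm v = w}

/-- The law of a random symbol which is nonzero with probability `θ`, and then uniform among the
nonzero symbols. -/
noncomputable def symbolLaw {F : Type*} [Zero F] [Fintype F] [DecidableEq F] (θ : ℝ) (x : F) : ℝ :=
  if x = 0 then 1 - θ else θ / (Fintype.card F - 1)

/-- The probability of each single word of length `N` and weight `w` when its symbols are
independent with law `symbolLaw θ`. -/
noncomputable def wordProb (F : Type*) [Fintype F] (θ : ℝ) (N w : ℕ) : ℝ :=
  (1 - θ) ^ (N - w) * (θ / (Fintype.card F - 1)) ^ w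

theorem wordProb_nonneg {F : Type*} [Fintype F] [Nonempty F] {θ : ℝ} (h0 : 0 ≤ θ) (h1 : θ ≤ 1)
    (N w : ℕ) : 0 ≤ wordProb F θ N w := by
  have hq : (1 : ℝ) ≤ Fintype.card F := Nat.one_le_cast.2 Fintype.card_pos
  exact mul_nonneg (pow_nonneg (sub_nonneg.2 h1) _) (pow_nonneg (div_nonneg h0 (sub_nonneg.2 hq)) _)

theorem wordProb_mul (F : Type*) [Fintype F] (θ : ℝ) (N w l : ℕ) :
    wordProb F θ (N * l) (w * l) = wordProb F θ N w ^ l := by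
  rw [wordProb, wordProb, mul_pow, ← pow_mul, ← pow_mul, ← Nat.sub_mul]

theorem one_lt_card_real (F : Type*) [Fintype F] [Nontrivial F] : (1 : ℝ) < Fintype.card F :=
  Nat.one_lt_cast.2 Fintype.one_lt_card

section Zero

variable {F ι : Type*} [Zero F] [Fintype F] [DecidableEq F] [Fintype ι]

theorem prod_symbolLaw (θ : ℝ) (v : ι → F) :
    ∏ i, symbolLaw θ (v i) = wordProb F θ (Fintype.card ι) (hammingNorm v) := by
  have zeros : #{i | v i = 0} = Fintype.card ι - hammingNorm v := by
    have := card_filter_add_card_filter_not (s := (univ : Finset ι)) (fun i => v i = 0)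
    rw [card_univ] at this
    exact Nat.eq_sub_of_add_eq this
  simp only [symbolLaw, prod_ite, prod_const, zeros]
  rfl

theorem sum_symbolLaw [Nontrivial F] (θ : ℝ) : ∑ x : F, symbolLaw θ x = 1 := by
  have hq : (Fintype.card F : ℝ) - 1 ≠ 0 := (sub_pos.2 (one_lt_card_real F)).ne'
  simp only [symbolLaw, sum_ite, sum_const, nsmul_eq_mul, filter_eq', filter_ne', mem_univ, if_true,
    card_singleton, card_erase_of_mem, card_univ]
  rw [Nat.cast_pred Fintype.card_pos, mul_div_cancel₀ _ hq]
  simp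

theorem symbolLaw_nonneg [Nontrivial F] {θ : ℝ} (h0 : 0 ≤ θ) (h1 : θ ≤ 1) (x : F) :
    0 ≤ symbolLaw θ x := by
  rw [symbolLaw]
  split_ifs
  · exact sub_nonneg.2 h1
  · exact div_nonneg h0 (sub_nonneg.2 (one_lt_card_real F).le)

variable [DecidableEq ι]

theorem card_filter_support_eq (s : Finset ι) :
    #{v : ι → F | ({i | v i ≠ 0} : Finset ι) = s} = (Fintype.card F - 1) ^ #s := by
  have support_eq : ({v : ι → F | ({i | v i ≠ 0} : Finset ι) = s} : Finset (ι → F)) =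
      Fintype.piFinset fun i => if i ∈ s then univ.erase (0 : F) else {0} := by
    ext v
    simp only [mem_filter, mem_univ, true_and, Fintype.mem_piFinset, Finset.ext_iff]
    refine forall_congr' fun i => ?_
    by_cases hi : i ∈ s <;> simp [hi]
  simp [support_eq, Fintype.card_piFinset, apply_ite card, card_erase_of_mem]

theorem card_sphere (w : ℕ) :
    #(sphere F ι w) = (Fintype.card ι).choose w * (Fintype.card F - 1) ^ w := by
  have maps : ∀ v ∈ sphere F ι w, ({i | v i ≠ 0} : Finset ι) ∈ powersetCard w univ := by
    intro v hv
    exact mem_powersetCard.2 ⟨subset_univ _, (mem_filter.1 hv).2⟩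
  have fiber : ∀ s ∈ powersetCard w (univ : Finset ι),
      #{v ∈ sphere F ι w | ({i | v i ≠ 0} : Finset ι) = s} = (Fintype.card F - 1) ^ w := by
    intro s hs
    rw [← (mem_powersetCard.1 hs).2, ← card_filter_support_eq (F := F) s, sphere, filter_filter]
    congr 1
    exact filter_congr fun v _ => and_iff_right_of_imp fun h => h ▸ rfl
  rw [card_eq_sum_card_fiberwise maps, sum_const_nat fiber, card_powersetCard, card_univ]

theorem card_sphere_mul_wordProb [Nontrivial F] (θ : ℝ) (w : ℕ) :
    #(sphere F ι w) * wordProb F θ (Fintype.card ι) w =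
      (Fintype.card ι).choose w * θ ^ w * (1 - θ) ^ (Fintype.card ι - w) := by
  have hq : (Fintype.card F : ℝ) - 1 ≠ 0 := (sub_pos.2 (one_lt_card_real F)).ne'
  rw [card_sphere, wordProb, Nat.cast_mul, Nat.cast_pow, Nat.cast_pred Fintype.card_pos, div_pow]
  field_simp

end Zero

theorem exists_perm_units_of_hammingNorm_eq {F ι : Type*} [GroupWithZero F] [DecidableEq F]
    [Fintype ι] {v w : ι → F} (h : hammingNorm v = hammingNorm w) :
    ∃ (σ : Equiv.Perm ι) (a : ι → Fˣ), ∀ s, w (σ s) = a s * v s := by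
  have card_eq : Fintype.card {i // v i ≠ 0} = Fintype.card {i // w i ≠ 0} := by
    rwa [Fintype.card_subtype, Fintype.card_subtype]
  let e : {i // v i ≠ 0} ≃ {i // w i ≠ 0} := Fintype.equivOfCardEq card_eq
  have image_ne_zero (s : ι) (hs : v s ≠ 0) : w (e.extendSubtype s) ≠ 0 :=
    e.extendSubtype_mem s hs
  have image_eq_zero (s : ι) (hs : v s = 0) : w (e.extendSubtype s) = 0 :=
    not_not.1 (e.extendSubtype_not_mem s (not_not.2 hs))
  refine ⟨e.extendSubtype, fun s => if hs : v s = 0 then 1 else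
    Units.mk0 (w (e.extendSubtype s) / v s) (div_ne_zero (image_ne_zero s hs) hs), fun s => ?_⟩
  by_cases hs : v s = 0
  · rw [image_eq_zero s hs, hs, mul_zero]
  · simp only [dif_neg hs, Units.val_mk0, div_mul_cancel₀ _ hs]

end Hamming

section LoomisWhitney

theorem sum_prod_eq_one {ι α : Type*} [Fintype ι] [DecidableEq ι] [Fintype α] {f : α → ℝ}
    (hf : ∑ x, f x = 1) : ∑ v : ι → α, ∏ i, f (v i) = 1 := by
  rw [← Fintype.piFinset_univ, sum_prod_piFinset univ fun _ => f]
  simp only [hf, prod_const_one]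

variable {ι κ α : Type*} [Fintype ι] [Fintype κ] [Fintype α]

theorem sum_prod_filter_le_one {p : ι → Prop} [DecidablePred p] {A : Finset (ι → α)}
    (hA : Set.InjOn (Subtype.restrict p) (A : Set (ι → α))) {f : α → ℝ} (f_nonneg : ∀ x, 0 ≤ f x)
    (sum_f : ∑ x, f x = 1) : ∑ v ∈ A, ∏ i with p i, f (v i) ≤ 1 := by
  classical
  calc ∑ v ∈ A, ∏ i with p i, f (v i)
      = ∑ v ∈ A, ∏ i : Subtype p, f (Subtype.restrict p v i) :=
        sum_congr rfl fun v _ => prod_subtype _ (fun _ => mem_filter_univ _) _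
    _ = ∑ w ∈ A.image (Subtype.restrict p), ∏ i, f (w i) :=
        (sum_image (f := fun w : Subtype p → α => ∏ i, f (w i)) hA).symm
    _ ≤ ∑ w : Subtype p → α, ∏ i, f (w i) :=
        sum_le_sum_of_subset_of_nonneg (subset_univ _)
          fun _ _ _ => prod_nonneg fun _ _ => f_nonneg _
    _ = 1 := sum_prod_eq_one sum_f

theorem prod_prod_filter_ne [DecidableEq κ] (c : ι → κ) (x : ι → ℝ) :
    ∏ t, ∏ i with c i ≠ t, x i = (∏ i, x i) ^ (Fintype.card κ - 1) := by
  rw [prod_comm' (s' := fun i => univ.erase (c i)) (t' := univ) (by simp [ne_comm])]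
  simp only [prod_const, card_erase_of_mem, mem_univ, card_univ, prod_pow]

variable [Nonempty κ]

theorem prod_rpow_one_sub_inv_le_sum [DecidableEq κ] (c : ι → κ) {x : ι → ℝ} (hx : ∀ i, 0 ≤ x i) :
    (∏ i, x i) ^ (1 - (Fintype.card κ : ℝ)⁻¹) ≤
      ∑ t, (Fintype.card κ : ℝ)⁻¹ * ∏ i with c i ≠ t, x i := by
  have card_ne : (Fintype.card κ : ℝ) ≠ 0 := Nat.cast_ne_zero.2 Fintype.card_ne_zero
  have exponent : ((Fintype.card κ - 1 : ℕ) : ℝ) * (Fintype.card κ : ℝ)⁻¹ =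
      1 - (Fintype.card κ : ℝ)⁻¹ := by
    rw [Nat.cast_pred Fintype.card_pos, sub_mul, mul_inv_cancel₀ card_ne, one_mul]
  have marginal_nonneg (t : κ) : 0 ≤ ∏ i with c i ≠ t, x i := prod_nonneg fun i _ => hx i
  calc (∏ i, x i) ^ (1 - (Fintype.card κ : ℝ)⁻¹)
      = ∏ t, (∏ i with c i ≠ t, x i) ^ (Fintype.card κ : ℝ)⁻¹ := by
        rw [Real.finsetProd_rpow _ _ fun t _ => marginal_nonneg t, prod_prod_filter_ne,
          ← Real.rpow_natCast, ← Real.rpow_mul (prod_nonneg fun i _ => hx i), exponent]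
    _ ≤ ∑ t, (Fintype.card κ : ℝ)⁻¹ * ∏ i with c i ≠ t, x i :=
        Real.geom_mean_le_arith_mean_weighted univ _ _ (fun _ _ => by positivity)
          (by rw [sum_const, card_univ, nsmul_eq_mul, mul_inv_cancel₀ card_ne])
          fun t _ => marginal_nonneg t

theorem sum_prod_rpow_one_sub_inv_le_one {c : ι → κ} {A : Finset (ι → α)}
    (hA : ∀ t, Set.InjOn (Subtype.restrict fun i => c i ≠ t) (A : Set (ι → α))) {f : α → ℝ}
    (f_nonneg : ∀ x, 0 ≤ f x) (sum_f : ∑ x, f x = 1) :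
    ∑ v ∈ A, (∏ i, f (v i)) ^ (1 - (Fintype.card κ : ℝ)⁻¹) ≤ 1 := by
  classical
  calc ∑ v ∈ A, (∏ i, f (v i)) ^ (1 - (Fintype.card κ : ℝ)⁻¹)
      ≤ ∑ v ∈ A, ∑ t, (Fintype.card κ : ℝ)⁻¹ * ∏ i with c i ≠ t, f (v i) :=
        sum_le_sum fun v _ => prod_rpow_one_sub_inv_le_sum c fun i => f_nonneg (v i)
    _ = ∑ t, (Fintype.card κ : ℝ)⁻¹ * ∑ v ∈ A, ∏ i with c i ≠ t, f (v i) := by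
        rw [sum_comm]; simp only [mul_sum]
    _ ≤ ∑ _t : κ, (Fintype.card κ : ℝ)⁻¹ * 1 := by
        gcongr with t
        exact sum_prod_filter_le_one (hA t) f_nonneg sum_f
    _ = 1 := by simp

end LoomisWhitney

section CheckCode

/-- The words on the check-node sockets `ρ × κ` that satisfy the unlabelled parity check of every
check node `j : ρ`; edge labels are absorbed in the words. -/
def checkCode (F ρ κ : Type*) [AddCommMonoid F] [Fintype F] [DecidableEq F] [Fintype ρ]
    [DecidableEq ρ] [Fintype κ] [DecidableEq κ] : Finset (ρ × κ → F) :=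
  {v | ∀ j, ∑ t, v (j, t) = 0}

variable {F ρ κ : Type*} [AddCommGroup F] [Fintype F] [DecidableEq F] [Fintype ρ] [DecidableEq ρ]
  [Fintype κ] [DecidableEq κ]

theorem injOn_restrict_checkCode (t : κ) :
    Set.InjOn (Subtype.restrict fun s : ρ × κ => s.2 ≠ t) (checkCode F ρ κ : Set (ρ × κ → F)) := by
  intro v hv w hw hvw
  have agree (j : ρ) (t' : κ) (ht' : t' ≠ t) : v (j, t') = w (j, t') :=
    congrFun hvw ⟨(j, t'), ht'⟩
  have checks : ∀ j, ∑ t, v (j, t) = ∑ t, w (j, t) := fun j =>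
    ((mem_filter.1 hv).2 j).trans ((mem_filter.1 hw).2 j).symm
  funext ⟨j, t'⟩
  obtain rfl | ht' := eq_or_ne t' t
  · have erased : ∑ t ∈ univ.erase t', v (j, t) = ∑ t ∈ univ.erase t', w (j, t) :=
      sum_congr rfl fun t ht => agree j t (ne_of_mem_erase ht)
    have := checks j
    rw [← add_sum_erase _ _ (mem_univ t'), ← add_sum_erase _ (fun t => w (j, t)) (mem_univ t'),
      erased] at this
    exact add_right_cancel this
  · exact agree j t' ht'

theorem card_checkCode_inter_sphere_mul_le_one [Nontrivial F] [Nonempty κ] {θ : ℝ} (h0 : 0 ≤ θ)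
    (h1 : θ ≤ 1) (w : ℕ) :
    #(checkCode F ρ κ ∩ sphere F (ρ × κ) w) *
      wordProb F θ (Fintype.card (ρ × κ)) w ^ (1 - (Fintype.card κ : ℝ)⁻¹) ≤ 1 := by
  have inj (t : κ) : Set.InjOn (Subtype.restrict (β := fun _ => F) fun s : ρ × κ => s.2 ≠ t)
      (checkCode F ρ κ ∩ sphere F (ρ × κ) w : Finset (ρ × κ → F)) :=
    (injOn_restrict_checkCode t).mono (coe_subset.2 inter_subset_left)
  refine le_of_eq_of_le ?_
    (sum_prod_rpow_one_sub_inv_le_one inj (symbolLaw_nonneg h0 h1) (sum_symbolLaw θ))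
  rw [← nsmul_eq_mul, ← sum_const]
  refine sum_congr rfl fun v hv => ?_
  rw [prod_symbolLaw, (mem_filter.1 (mem_inter.1 hv).2).2]

end CheckCode

section Uniform

theorem uniformOn_univ_preimage_equiv {α : Type*} [MeasurableSpace α] [DiscreteMeasurableSpace α]
    (e : α ≃ α) (s : Set α) : uniformOn Set.univ (e ⁻¹' s) = uniformOn Set.univ s := by
  simp only [uniformOn, cond_apply MeasurableSet.univ, Set.univ_inter,
    Measure.count_apply (MeasurableSet.of_discrete), Set.encard_preimage_of_bijective e.bijective]

theorem measureReal_preimage_mul_card {α β : Type*} [MeasurableSpace α] [DiscreteMeasurableSpace α]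
    {μ : Measure α} [IsProbabilityMeasure μ] {f : α → β} {S A : Finset β} (hf : ∀ x, f x ∈ S)
    (hμ : ∀ y ∈ S, ∀ z ∈ S, μ.real (f ⁻¹' {y}) = μ.real (f ⁻¹' {z})) (hA : A ⊆ S) :
    μ.real (f ⁻¹' A) * #S = #A := by
  have sum_fiber (B : Finset β) : ∑ y ∈ B, μ.real (f ⁻¹' {y}) = μ.real (f ⁻¹' B) :=
    sum_measureReal_preimage_singleton B fun _ _ => MeasurableSet.of_discrete
  have preimage_S : f ⁻¹' S = Set.univ := Set.eq_univ_of_forall hf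
  calc μ.real (f ⁻¹' A) * #S = ∑ _z ∈ S, ∑ y ∈ A, μ.real (f ⁻¹' {y}) := by
        rw [sum_const, sum_fiber, nsmul_eq_mul, mul_comm]
    _ = ∑ z ∈ S, ∑ _y ∈ A, μ.real (f ⁻¹' {z}) :=
        sum_congr rfl fun z hz => sum_congr rfl fun y hy => hμ y (hA hy) z hz
    _ = #A := by
        rw [sum_comm, sum_fiber, preimage_S, probReal_univ, sum_const, nsmul_one]

end Uniform

namespace TannerGraph

variable {F : Type*} [Field F] {l d n r : ℕ}

/-- The word on the check-node sockets received from `u`: each variable node copies its symbol to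
its sockets, and each edge multiplies it by its label. -/
def socketWord (G : TannerGraph F l d n r) (u : Fin n → F) (s : Fin r × Fin d) : F :=
  G.label (G.perm.symm s) * u (G.perm.symm s).1

/-- The action on Tanner graphs of a monomial transformation of the check-node sockets: permute the
sockets by `σ`, after scaling the edge at the socket `s` by `a s`. -/
def monomialEquiv (σ : Equiv.Perm (Fin r × Fin d)) (a : Fin r × Fin d → Fˣ) :
    TannerGraph F l d n r ≃ TannerGraph F l d n r where
  toFun G := ⟨G.perm.trans σ, fun e => a (G.perm e) * G.label e⟩
  invFun G := ⟨G.perm.trans σ.symm, fun e => (a (σ.symm (G.perm e)))⁻¹ * G.label e⟩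
  left_inv G := by simp [Equiv.trans_assoc]
  right_inv G := by simp [Equiv.trans_assoc]

theorem socketWord_monomialEquiv (σ : Equiv.Perm (Fin r × Fin d)) (a : Fin r × Fin d → Fˣ)
    (G : TannerGraph F l d n r) (u : Fin n → F) (s : Fin r × Fin d) :
    (monomialEquiv σ a G).socketWord u (σ s) = a s * G.socketWord u s := by
  simp [socketWord, monomialEquiv, mul_assoc]

theorem hammingNorm_socketWord [DecidableEq F] (G : TannerGraph F l d n r) (u : Fin n → F) :
    hammingNorm (G.socketWord u) = hammingNorm u * l := by
  have support_eq : ({s | G.socketWord u s ≠ 0} : Finset (Fin r × Fin d)) =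
      (({i | u i ≠ 0} : Finset (Fin n)) ×ˢ (univ : Finset (Fin l))).map G.perm.toEmbedding := by
    ext s
    simp [socketWord]
  rw [hammingNorm, support_eq, card_map, card_product, card_univ, Fintype.card_fin, hammingNorm]

theorem sum_edgesAt (G : TannerGraph F l d n r) (u : Fin n → F) (j : Fin r) :
    ∑ e ∈ G.edgesAt j, (G.label e : F) * u e.1 = ∑ t, G.socketWord u (j, t) := by
  have check_eq {e : Fin n × Fin l} (he : e ∈ G.edgesAt j) : (j, (G.perm e).2) = G.perm e :=
    Prod.ext (mem_filter.1 he).2.symm rfl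
  refine sum_nbij' (fun e => (G.perm e).2) (fun t => G.perm.symm (j, t)) (fun _ _ => mem_univ _)
    (fun t _ => by simp [edgesAt]) (fun e he => ?_) (fun t _ => by simp) (fun e he => ?_)
  · rw [check_eq he, Equiv.symm_apply_apply]
  · rw [check_eq he, socketWord, Equiv.symm_apply_apply]

theorem mem_codebook_iff [Fintype F] [DecidableEq F] (G : TannerGraph F l d n r) (u : Fin n → F) :
    u ∈ G.codebook ↔ G.socketWord u ∈ checkCode F (Fin r) (Fin d) := by
  simp only [codebook, checkCode, Set.mem_ofPred_eq, mem_filter_univ, sum_edgesAt]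

theorem one_le_ncard_codebook [Finite F] (G : TannerGraph F l d n r) :
    (1 : ℝ) ≤ G.codebook.ncard := by
  have zero_mem : 0 ∈ G.codebook := fun j => by simp
  exact Nat.one_le_cast.2 ((Set.ncard_pos (Set.toFinite _)).2 ⟨0, zero_mem⟩)

end TannerGraph

section CodewordProbability

variable {F : Type*} [Field F] [DecidableEq F] {l d n r : ℕ}

theorem measureReal_socketWord_eq (u : Fin n → F) {v w : Fin r × Fin d → F}
    (hvw : hammingNorm v = hammingNorm w) :
    (fullEnsemble F l d n r).real ((fun G => G.socketWord u) ⁻¹' {v}) =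
      (fullEnsemble F l d n r).real ((fun G => G.socketWord u) ⁻¹' {w}) := by
  obtain ⟨σ, a, hσa⟩ := exists_perm_units_of_hammingNorm_eq hvw
  have preimage_eq : (fun G : TannerGraph F l d n r => G.socketWord u) ⁻¹' {v} =
      TannerGraph.monomialEquiv σ a ⁻¹' ((fun G => G.socketWord u) ⁻¹' {w}) := by
    ext G
    simp only [Set.mem_preimage, Set.mem_singleton_iff, funext_iff]
    rw [← σ.forall_congr_right (q := fun s => _ = w s)]
    simp only [TannerGraph.socketWord_monomialEquiv, hσa, Units.mul_right_inj]
  rw [measureReal_def, preimage_eq, fullEnsemble, uniformOn_univ_preimage_equiv, measureReal_def]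

variable [Fintype F]

theorem measureReal_mem_codebook_mul_card (h : n * l = r * d) (u : Fin n → F) :
    (fullEnsemble F l d n r).real {G | u ∈ G.codebook} *
        #(sphere F (Fin r × Fin d) (hammingNorm u * l)) =
      #(checkCode F (Fin r) (Fin d) ∩ sphere F (Fin r × Fin d) (hammingNorm u * l)) := by
  have := isProbabilityMeasure_fullEnsemble F h
  have socketWord_mem (G : TannerGraph F l d n r) :
      G.socketWord u ∈ sphere F (Fin r × Fin d) (hammingNorm u * l) :=
    (mem_filter_univ _).2 (G.hammingNorm_socketWord u)
  have preimage_eq : {G : TannerGraph F l d n r | u ∈ G.codebook} =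
      (fun G => G.socketWord u) ⁻¹'
        ↑(checkCode F (Fin r) (Fin d) ∩ sphere F (Fin r × Fin d) (hammingNorm u * l)) := by
    ext G
    simp [G.mem_codebook_iff, socketWord_mem G]
  rw [preimage_eq]
  exact measureReal_preimage_mul_card socketWord_mem
    (fun v hv w hw => measureReal_socketWord_eq u
      (((mem_filter_univ _).1 hv).trans ((mem_filter_univ _).1 hw).symm))
    inter_subset_right

theorem measureReal_mem_codebook_le_wordProb (h : n * l = r * d) (hd : 0 < d) (u : Fin n → F)
    {θ : ℝ} (h0 : 0 ≤ θ) (h1 : θ ≤ 1) (hθ : θ * n = hammingNorm u) :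
    (fullEnsemble F l d n r).real {G | u ∈ G.codebook} ≤
      (n * l + 1) * wordProb F θ n (hammingNorm u) ^ (l / d : ℝ) := by
  have : NeZero d := ⟨hd.ne'⟩
  set w := hammingNorm u
  set p := (fullEnsemble F l d n r).real {G | u ∈ G.codebook}
  set D := wordProb F θ n w
  have card_sockets : Fintype.card (Fin r × Fin d) = n * l := by simp [h]
  have sphere_prob :
      1 ≤ ((n * l : ℕ) + 1) * (#(sphere F (Fin r × Fin d) (w * l)) * D ^ l) := by
    rw [← wordProb_mul, ← card_sockets, card_sphere_mul_wordProb, card_sockets]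
    have weight_le : w ≤ n := by simpa using hammingNorm_le_card_fintype (x := u)
    exact one_le_mul_binomial_mean (Nat.mul_le_mul_right l weight_le)
      (by rw [Nat.cast_mul, Nat.cast_mul, ← mul_assoc, hθ])
  have check_prob : #(checkCode F (Fin r) (Fin d) ∩ sphere F (Fin r × Fin d) (w * l)) *
      (D ^ l) ^ (1 - (d : ℝ)⁻¹) ≤ 1 := by
    have := card_checkCode_inter_sphere_mul_le_one (F := F) (ρ := Fin r) (κ := Fin d) h0 h1 (w * l)
    rwa [card_sockets, wordProb_mul, Fintype.card_fin] at this
  have D_nonneg : 0 ≤ D := wordProb_nonneg h0 h1 n w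
  have D_pow_pos : 0 < D ^ l := (pow_nonneg D_nonneg l).lt_of_ne fun D_pow_eq => by
    norm_num [← D_pow_eq] at sphere_prob
  have split_power : D ^ l = (D ^ l) ^ (1 - (d : ℝ)⁻¹) * D ^ (l / d : ℝ) := by
    rw [div_eq_mul_inv, Real.rpow_mul D_nonneg, Real.rpow_natCast, ← Real.rpow_add D_pow_pos,
      sub_add_cancel, Real.rpow_one]
  calc p ≤ p * (((n * l : ℕ) + 1) * (#(sphere F (Fin r × Fin d) (w * l)) * D ^ l)) :=
        le_mul_of_one_le_right measureReal_nonneg sphere_prob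
    _ = (n * l + 1) * ((p * #(sphere F (Fin r × Fin d) (w * l))) * D ^ l) := by push_cast; ring
    _ = (n * l + 1) * ((#(checkCode F (Fin r) (Fin d) ∩ sphere F (Fin r × Fin d) (w * l)) *
          (D ^ l) ^ (1 - (d : ℝ)⁻¹)) * D ^ (l / d : ℝ)) := by
        rw [measureReal_mem_codebook_mul_card h, mul_assoc (#_ : ℝ), ← split_power]
    _ ≤ (n * l + 1) * (1 * D ^ (l / d : ℝ)) := by gcongr
    _ = (n * l + 1) * D ^ (l / d : ℝ) := by rw [one_mul]

theorem measureReal_mem_codebook_le (h : n * l = r * d) (hd : 0 < d) (u : Fin n → F) :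
    (fullEnsemble F l d n r).real {G | u ∈ G.codebook} ≤
      (n * l + 1) * (#(sphere F (Fin n) (hammingNorm u)) : ℝ) ^ (-(l / d : ℝ)) := by
  have weight_le : hammingNorm u ≤ n := by simpa using hammingNorm_le_card_fintype (x := u)
  set θ : ℝ := hammingNorm u / n
  have h0 : 0 ≤ θ := by positivity
  have h1 : θ ≤ 1 := div_le_one_of_le₀ (Nat.cast_le.2 weight_le) (Nat.cast_nonneg n)
  have hθ : θ * n = hammingNorm u := div_mul_cancel_of_imp fun hn => by
    rw [Nat.cast_eq_zero] at hn ⊢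
    omega
  have sphere_pos : 0 < (#(sphere F (Fin n) (hammingNorm u)) : ℝ) :=
    Nat.cast_pos.2 (card_pos.2 ⟨u, (mem_filter_univ u).2 rfl⟩)
  have wordProb_le :
      wordProb F θ n (hammingNorm u) ≤ (#(sphere F (Fin n) (hammingNorm u)) : ℝ)⁻¹ := by
    have := card_sphere_mul_wordProb (F := F) (ι := Fin n) θ (hammingNorm u)
    rw [Fintype.card_fin] at this
    rw [← one_div, le_div_iff₀' sphere_pos, this]
    exact choose_mul_pow_mul_pow_le_one weight_le h0 h1
  calc (fullEnsemble F l d n r).real {G | u ∈ G.codebook}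
      ≤ (n * l + 1) * wordProb F θ n (hammingNorm u) ^ (l / d : ℝ) :=
        measureReal_mem_codebook_le_wordProb h hd u h0 h1 hθ
    _ ≤ (n * l + 1) * (#(sphere F (Fin n) (hammingNorm u)) : ℝ)⁻¹ ^ (l / d : ℝ) := by
        gcongr
        exact wordProb_nonneg h0 h1 n (hammingNorm u)
    _ = (n * l + 1) * (#(sphere F (Fin n) (hammingNorm u)) : ℝ) ^ (-(l / d : ℝ)) := by
        rw [Real.inv_rpow sphere_pos.le, Real.rpow_neg sphere_pos.le]

end CodewordProbability

theorem integral_log_le_log_integral {α : Type*} [MeasurableSpace α] {μ : Measure α}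
    [IsProbabilityMeasure μ] {f : α → ℝ} {c : ℝ} (hc : 0 < c) (hf : ∀ᵐ x ∂μ, c ≤ f x)
    (hfi : Integrable f μ) (hlog : Integrable (fun x => Real.log (f x)) μ) :
    ∫ x, Real.log (f x) ∂μ ≤ Real.log (∫ x, f x ∂μ) := by
  have concave : ConcaveOn ℝ (Set.Ici c) Real.log :=
    strictConcaveOn_log_Ioi.concaveOn.subset (Set.Ici_subset_Ioi.2 hc) (convex_Ici c)
  have continuous : ContinuousOn Real.log (Set.Ici c) :=
    Real.continuousOn_log.mono fun _ hx => (hc.trans_le hx).ne'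
  exact concave.le_map_integral continuous isClosed_Ici hf hfi hlog

theorem integral_ncard_eq_sum {α β : Type*} [MeasurableSpace α] {μ : Measure α} [IsFiniteMeasure μ]
    [Fintype β] {S : α → Set β} (hS : ∀ b, MeasurableSet {a | b ∈ S a}) :
    ∫ a, ((S a).ncard : ℝ) ∂μ = ∑ b, μ.real {a | b ∈ S a} := by
  classical
  have ncard_eq (a : α) : ((S a).ncard : ℝ) = ∑ b, {a | b ∈ S a}.indicator 1 a := by
    simp [Set.ncard_eq_toFinset_card', Set.indicator_apply]
  simp only [ncard_eq]
  rw [integral_finsetSum _ fun b _ => (integrable_const 1).indicator (hS b)]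
  exact sum_congr rfl fun b _ => integral_indicator_one (hS b)

section Rate

variable {F : Type*} [Field F] [Fintype F] {l d n r : ℕ}

theorem integral_ncard_codebook_le (h : n * l = r * d) (hd : 0 < d) (hld : l ≤ d) :
    ∫ G, (G.codebook.ncard : ℝ) ∂(fullEnsemble F l d n r) ≤
      (n * l + 1) * (n + 1) * (Fintype.card F : ℝ) ^ (n * designRate l d) := by
  classical
  have := isProbabilityMeasure_fullEnsemble F h
  have weight_mem (u : Fin n → F) : hammingNorm u ∈ range (n + 1) :=
    mem_range.2 (Nat.lt_succ_of_le (by simpa using hammingNorm_le_card_fintype (x := u)))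
  have ratio_le : (l / d : ℝ) ≤ 1 := div_le_one_of_le₀ (Nat.cast_le.2 hld) (Nat.cast_nonneg d)
  calc ∫ G, (G.codebook.ncard : ℝ) ∂(fullEnsemble F l d n r)
      = ∑ u : Fin n → F, (fullEnsemble F l d n r).real {G | u ∈ G.codebook} :=
        integral_ncard_eq_sum fun _ => MeasurableSet.of_discrete
    _ ≤ ∑ u : Fin n → F,
          (n * l + 1) * (#(sphere F (Fin n) (hammingNorm u)) : ℝ) ^ (-(l / d : ℝ)) :=
        sum_le_sum fun u _ => measureReal_mem_codebook_le h hd u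
    _ = (n * l + 1) *
          ∑ u : Fin n → F, (#(sphere F (Fin n) (hammingNorm u)) : ℝ) ^ (-(l / d : ℝ)) := by
        rw [mul_sum]
    _ ≤ (n * l + 1) *
          (#(range (n + 1)) * (Fintype.card (Fin n → F) : ℝ) ^ (1 - (l / d : ℝ))) := by
        gcongr
        exact sum_card_fiber_rpow_neg_le weight_mem ratio_le
    _ = (n * l + 1) * (n + 1) * (Fintype.card F : ℝ) ^ (n * designRate l d) := by
        rw [designRate, Real.rpow_mul (Nat.cast_nonneg _), Real.rpow_natCast, card_range,
          Fintype.card_fun, Fintype.card_fin]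
        push_cast
        ring

theorem measureReal_rate_sub_designRate_gt_le (h : n * l = r * d) (hn : 0 < n) (hd : 0 < d)
    (hld : l ≤ d) (ε : ℝ) :
    (fullEnsemble F l d n r).real {G | G.rate - designRate l d > ε} ≤
      (n * l + 1) * (n + 1) * (Fintype.card F : ℝ) ^ (-(n * ε)) := by
  have := isProbabilityMeasure_fullEnsemble F h
  have hq := one_lt_card_real F
  have hq0 : (0 : ℝ) < Fintype.card F := one_pos.trans hq
  set threshold : ℝ := (Fintype.card F : ℝ) ^ (n * (designRate l d + ε))
  have threshold_pos : 0 < threshold := Real.rpow_pos_of_pos hq0 _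
  have many_codewords : {G : TannerGraph F l d n r | G.rate - designRate l d > ε} ⊆
      {G | threshold ≤ (G.codebook.ncard : ℝ)} := by
    intro G (hG : ε < G.rate - designRate l d)
    refine (Real.le_logb_iff_rpow_le hq (one_pos.trans_le G.one_le_ncard_codebook)).1 ?_
    exact (le_div_iff₀' (Nat.cast_pos.2 hn)).1 (lt_sub_iff_add_lt'.1 hG).le
  refine (measureReal_mono many_codewords).trans (le_of_mul_le_mul_left ?_ threshold_pos)
  calc threshold * (fullEnsemble F l d n r).real {G | threshold ≤ (G.codebook.ncard : ℝ)}
      ≤ ∫ G, (G.codebook.ncard : ℝ) ∂(fullEnsemble F l d n r) :=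
        mul_meas_ge_le_integral_of_nonneg (.of_forall fun _ => Nat.cast_nonneg _)
          .of_finite threshold
    _ ≤ (n * l + 1) * (n + 1) * (Fintype.card F : ℝ) ^ (n * designRate l d) :=
        integral_ncard_codebook_le h hd hld
    _ = (n * l + 1) * (n + 1) * (threshold * (Fintype.card F : ℝ) ^ (-(n * ε))) := by
        rw [← Real.rpow_add hq0]
        ring_nf
    _ = threshold * ((n * l + 1) * (n + 1) * (Fintype.card F : ℝ) ^ (-(n * ε))) := by ring

theorem integral_rate_le (h : n * l = r * d) :
    ∫ G, G.rate ∂(fullEnsemble F l d n r) ≤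
      Real.logb (Fintype.card F) (∫ G, (G.codebook.ncard : ℝ) ∂(fullEnsemble F l d n r)) / n := by
  have := isProbabilityMeasure_fullEnsemble F h
  simp only [TannerGraph.rate, Real.logb, integral_div]
  gcongr
  exact integral_log_le_log_integral one_pos (.of_forall fun G => G.one_le_ncard_codebook)
    .of_finite .of_finite

theorem integral_rate_sub_designRate_le (h : n * l = r * d) (hn : 0 < n) (hd : 0 < d)
    (hld : l ≤ d) :
    ∫ G, (G.rate - designRate l d) ∂(fullEnsemble F l d n r) ≤
      Real.logb (Fintype.card F) ((n * l + 1) * (n + 1)) / n := by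
  have := isProbabilityMeasure_fullEnsemble F h
  have hq := one_lt_card_real F
  have hq0 : (0 : ℝ) < Fintype.card F := one_pos.trans hq
  have mean_pos : 0 < ∫ G, (G.codebook.ncard : ℝ) ∂(fullEnsemble F l d n r) := by
    refine one_pos.trans_le ?_
    simpa using integral_mono (μ := fullEnsemble F l d n r) .of_finite .of_finite
      fun G => G.one_le_ncard_codebook
  rw [integral_sub .of_finite .of_finite, integral_const, probReal_univ, one_smul,
    sub_le_iff_le_add]
  calc ∫ G, G.rate ∂(fullEnsemble F l d n r)
      ≤ Real.logb (Fintype.card F) (∫ G, (G.codebook.ncard : ℝ) ∂(fullEnsemble F l d n r)) / n :=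
        integral_rate_le h
    _ ≤ Real.logb (Fintype.card F)
          ((n * l + 1) * (n + 1) * (Fintype.card F : ℝ) ^ (n * designRate l d)) / n := by
        gcongr
        exact integral_ncard_codebook_le h hd hld
    _ = Real.logb (Fintype.card F) ((n * l + 1) * (n + 1)) / n + designRate l d := by
        rw [Real.logb_mul (by positivity) (by positivity), Real.logb_rpow hq0 hq.ne', add_div,
          mul_div_cancel_left₀ _ (Nat.cast_ne_zero.2 hn.ne')]

end Rate

section Asymptotics

theorem mul_add_one_mul_add_one_le_pow_three {l n : ℕ} (h : 2 * (l + 1) ≤ n) :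
    (n * l + 1) * (n + 1) ≤ n ^ 3 := by
  calc (n * l + 1) * (n + 1) ≤ (n * (l + 1)) * (2 * n) :=
        Nat.mul_le_mul (by rw [mul_add_one]; omega) (by omega)
    _ = n ^ 2 * (2 * (l + 1)) := by ring
    _ ≤ n ^ 2 * n := Nat.mul_le_mul_left _ h
    _ = n ^ 3 := by ring

theorem eventually_pow_le_rpow_mul (k : ℕ) {a b : ℝ} (ha : 1 < a) (hb : 0 < b) :
    ∀ᶠ n : ℕ in Filter.atTop, (n : ℝ) ^ k ≤ a ^ (n * b) := by
  have ha0 : 0 ≤ a := zero_le_one.trans ha.le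
  have base : 1 < a ^ b := Real.one_lt_rpow ha hb
  filter_upwards [(tendsto_pow_const_div_const_pow_of_one_lt k base).eventually_le_const one_pos]
    with n hn
  rwa [div_le_one (by positivity), ← Real.rpow_mul_natCast ha0, mul_comm b] at hn

end Asymptotics

end LDPC

theorem mainTheorem10 (F : Type*) [Field F] [Fintype F] (l d : ℕ) (hl : 1 ≤ l) (hld : l ≤ d)
    (ε : ℝ) (hε : 0 < ε) :
    ∃ N : ℕ,
      (∀ n r : ℕ, N < n → n * l = r * d →
        (LDPC.fullEnsemble F l d n r).real {G | G.rate - LDPC.designRate l d > ε}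
          ≤ (Fintype.card F : ℝ) ^ (-((n : ℝ) * ε / 2))) ∧
      ∃ T₀ : ℝ, 0 < T₀ ∧ ∀ n r : ℕ, N < n → n * l = r * d →
        ∫ G, (G.rate - LDPC.designRate l d) ∂(LDPC.fullEnsemble F l d n r)
          ≤ T₀ * (Real.logb (Fintype.card F) n / n) := by
  have hq := LDPC.one_lt_card_real F
  have hd : 0 < d := hl.trans hld
  obtain ⟨N, hN⟩ := Filter.eventually_atTop.1
    ((LDPC.eventually_pow_le_rpow_mul 3 hq (half_pos hε)).and
      (Filter.eventually_ge_atTop (2 * (l + 1))))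
  have poly_le (n : ℕ) (hn : N < n) : ((n * l + 1) * (n + 1) : ℝ) ≤ (n : ℝ) ^ 3 := by
    exact_mod_cast LDPC.mul_add_one_mul_add_one_le_pow_three (hN n hn.le).2
  refine ⟨N, fun n r hn h => ?_, 3, three_pos, fun n r hn h => ?_⟩
  · calc (LDPC.fullEnsemble F l d n r).real {G | G.rate - LDPC.designRate l d > ε}
        ≤ (n * l + 1) * (n + 1) * (Fintype.card F : ℝ) ^ (-(n * ε)) :=
          LDPC.measureReal_rate_sub_designRate_gt_le h (Nat.zero_lt_of_lt hn) hd hld ε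
      _ ≤ (Fintype.card F : ℝ) ^ (n * (ε / 2)) * (Fintype.card F : ℝ) ^ (-(n * ε)) := by
          gcongr
          exact (poly_le n hn).trans (hN n hn.le).1
      _ = (Fintype.card F : ℝ) ^ (-(n * ε / 2)) := by
          rw [← Real.rpow_add (one_pos.trans hq)]
          ring_nf
  · calc ∫ G, (G.rate - LDPC.designRate l d) ∂(LDPC.fullEnsemble F l d n r)
        ≤ Real.logb (Fintype.card F) ((n * l + 1) * (n + 1)) / n :=
          LDPC.integral_rate_sub_designRate_le h (Nat.zero_lt_of_lt hn) hd hld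
      _ ≤ Real.logb (Fintype.card F) ((n : ℝ) ^ 3) / n := by
          gcongr
          exact poly_le n hn
      _ = 3 * (Real.logb (Fintype.card F) n / n) := by
          rw [Real.logb_pow, Nat.cast_ofNat, mul_div_assoc]
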